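/- Let $K=\mathbb F_2$, let $C\le K^n$ be a self-dual binary linear code of length $n$ (that is, $C=C^\perp$ for the standard inner product), and let $p$ be an odd prime. Let $g\in\mathrm{Aut}(C)\le S_n$ be a coordinate permutation preserving $C$, of order $2p$, such that the involution $h=g^p$ has no fixed points on the $n$ coordinates. Write $C(h)=\{c\in C: c^h=c\}$ for the subcode of codewords fixed by $h$, let $w$ be the number of $2$-cycles of $g$, let $s(p)$ be the smallest positive integer $s$ with $p\mid 2^s-1$, and put $\nu=(p-1)/s(p)$ (an integer). Suppose that $n\equiv 0 \pmod 4$, that $s(p)$ is even and that $w$ is odd. Then $$\dim C(h)\ \ge\ \frac n4+\frac{s(p)\,\nu}{2}\ =\ \frac n4+\frac{p-1}{2}.$$ Moreover, list the $2$-cycles of $h$ in any way as $(a_1,b_1),\dots,(a_{n/2},b_{n/2})$ (for instance $(1,2),(3,4),\dots,(n-1,n)$ when $h=(1,2)(3,4)\cdots(n-1,n)$) and define the linear maps $$\pi: C(h)\to K^{n/2},\ \ \pi(c)=(c_{a_1},\dots,c_{a_{n/2}}),\qquad \phi: C\to K^{n/2},\ \ \phi(c)=(c_{a_1}+c_{b_1},\dots,c_{a_{n/2}}+c_{b_{n/2}}).$$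 Then $\dim C(h)=\dim\pi(C(h))$, and $\phi(C)$ is a proper subspace of its dual: $\phi(C)\subsetneq\phi(C)^\perp$. -/

import Mathlib

/-- The field with two elements. -/
abbrev K : Type := ZMod 2

/-- The smallest positive integer `s` such that `p ∣ 2 ^ s - 1`. -/
noncomputable def sOrd (p : ℕ) : ℕ := sInf {s : ℕ | 0 < s ∧ p ∣ 2 ^ s - 1}

/-- `ν = (p - 1) / s(p)`; the division is exact for an odd prime `p`. -/
noncomputable def nuOf (p : ℕ) : ℕ := (p - 1) / sOrd p

/-- The dual code `{v | ⟨v, c⟩ = 0 for all c ∈ C}` for the standard inner product. -/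
def dualCode {m : ℕ} (C : Submodule K (Fin m → K)) : Submodule K (Fin m → K) where
  carrier := {v | ∀ c ∈ C, ∑ i, v i * c i = 0}
  zero_mem' := by
    intro c _
    simp
  add_mem' := by
    intro u v hu hv c hc
    simp [add_mul, Finset.sum_add_distrib, hu c hc, hv c hc]
  smul_mem' := by
    intro a v hv c hc
    simp [mul_assoc, ← Finset.mul_sum, hv c hc]

/-- A binary linear code is self-dual if it equals its dual. -/
def IsSelfDualCode {m : ℕ} (C : Submodule K (Fin m → K)) : Prop := dualCode C = C

/-- The word `c ^ σ`, whose entry in position `σ i` is `c i`. -/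
def permWord {m : ℕ} (σ : Equiv.Perm (Fin m)) (c : Fin m → K) : Fin m → K :=
  fun i => c (σ.symm i)

/-- The automorphism group of a code: the permutations `σ` of the coordinates with
`C ^ σ = C`. -/
def codeAut {m : ℕ} (C : Submodule K (Fin m → K)) : Subgroup (Equiv.Perm (Fin m)) where
  carrier := {σ | ∀ c, permWord σ c ∈ C ↔ c ∈ C}
  one_mem' := fun _ => Iff.rfl
  mul_mem' := by
    intro σ τ hσ hτ c
    exact (hσ (permWord τ c)).trans (hτ c)
  inv_mem' := by
    intro σ hσ c
    have h := hσ (permWord σ⁻¹ c)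
    have e : permWord σ (permWord σ⁻¹ c) = c := by
      funext i
      exact congrArg c (σ.apply_symm_apply i)
    rw [e] at h
    exact h.symm

/-- `C(σ)`, the subcode of the codewords fixed by `σ`. -/
def fixedSubcode {m : ℕ} (C : Submodule K (Fin m → K)) (σ : Equiv.Perm (Fin m)) :
    Submodule K (Fin m → K) where
  carrier := {c | c ∈ C ∧ permWord σ c = c}
  zero_mem' := ⟨C.zero_mem, rfl⟩
  add_mem' := by
    rintro u v ⟨hu, hu'⟩ ⟨hv, hv'⟩
    refine ⟨C.add_mem hu hv, funext fun i => ?_⟩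
    exact congrArg₂ (· + ·) (congrFun hu' i) (congrFun hv' i)
  smul_mem' := by
    rintro a v ⟨hv, hv'⟩
    refine ⟨C.smul_mem a hv, funext fun i => ?_⟩
    exact congrArg (a * ·) (congrFun hv' i)

/-- `e` lists the coordinates as `n / 2` pairs `(e (j, 0), e (j, 1))`, which are the
`2`-cycles of the fixed point free involution `h`. The numbering `h = (1,2)(3,4)⋯(n-1,n)`
is the case in which `e (j, 0)` and `e (j, 1)` are consecutive. -/
def IsPairing {n : ℕ} (h : Equiv.Perm (Fin n)) (e : Fin (n / 2) × Fin 2 ≃ Fin n) : Prop :=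
  ∀ j, h (e (j, 0)) = e (j, 1) ∧ h (e (j, 1)) = e (j, 0)

/-- `π`, which reads off the first coordinate of each pair; it is used on `C(h)`, whose words
are constant on every pair. -/
def piMap {n : ℕ} (e : Fin (n / 2) × Fin 2 ≃ Fin n) : (Fin n → K) →ₗ[K] (Fin (n / 2) → K) where
  toFun c := fun j => c (e (j, 0))
  map_add' _ _ := rfl
  map_smul' _ _ := rfl

/-- `φ`, which adds the two coordinates of each pair. -/
def phiMap {n : ℕ} (e : Fin (n / 2) × Fin 2 ≃ Fin n) : (Fin n → K) →ₗ[K] (Fin (n / 2) → K) where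
  toFun c := fun j => c (e (j, 0)) + c (e (j, 1))
  map_add' u v := by
    funext j
    exact add_add_add_comm _ _ _ _
  map_smul' a v := by
    funext j
    exact (mul_add _ _ _).symm

open Module

/-! Let `D = φ(C)`. Then `D ⊆ D^⊥ = π(C(h))`, and `π` is injective on `C(h)`, so it suffices to show
`dim D^⊥/D ≥ p - 1`. Since `g` commutes with `h`, it induces a permutation `σ` of the `n/2` pairs
with `σ ^ p = 1` and exactly `w` fixed points. Over `K` the trace of `σ ^ i` on words is therefore
`n/2 = 0` if `p ∣ i` and `w = 1` otherwise. Because `s(p)` is even, `p ∣ 2 ^ r + 1` for some `r`, so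
`σ⁻¹ = σ ^ (2 ^ r)`, which has the same trace on `D` as `σ` by Frobenius. Hence `D` and `K^(n/2)/D^⊥
≅ D*` contribute equal traces, which cancel, and `D^⊥/D` carries the whole trace
(`trace_eq_trace_dualCode_quotient`). Such a trace sequence forces dimension at least `p - 1`
(`sub_one_le_finrank_of_trace_pow`). -/

/-! ### Traces of endomorphisms. -/

/-- A splitting gives `id = i t + s f`; multiply by `A` and use that traces are cyclic. -/
theorem LinearMap.trace_eq_add_of_exact {F V N U : Type*} [Field F]
    [AddCommGroup V] [Module F V] [FiniteDimensional F V]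
    [AddCommGroup N] [Module F N] [FiniteDimensional F N]
    [AddCommGroup U] [Module F U] [FiniteDimensional F U]
    (i : N →ₗ[F] V) (f : V →ₗ[F] U) (hi : Function.Injective i) (hf : Function.Surjective f)
    (hif : Function.Exact i f) (A : End F V) (AN : End F N) (AU : End F U)
    (hN : A ∘ₗ i = i ∘ₗ AN) (hU : f ∘ₗ A = AU ∘ₗ f) :
    LinearMap.trace F V A = LinearMap.trace F N AN + LinearMap.trace F U AU := by
  obtain ⟨r, hr⟩ := i.exists_leftInverse_of_injective (LinearMap.ker_eq_bot.mpr hi)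
  obtain ⟨s, hs⟩ := f.exists_rightInverse_of_surjective (LinearMap.range_eq_top.mpr hf)
  set t : V →ₗ[F] N := r ∘ₗ (LinearMap.id - s ∘ₗ f) with ht
  have hdec : i ∘ₗ t + s ∘ₗ f = LinearMap.id := by
    ext v
    have h0 : f (v - s (f v)) = 0 := by
      have := LinearMap.congr_fun hs (f v)
      simp at this
      simp [this]
    obtain ⟨y, hy⟩ := (hif _).mp h0
    have := LinearMap.congr_fun hr y
    simp only [LinearMap.comp_apply, LinearMap.id_apply] at this
    simp only [ht, LinearMap.add_apply, LinearMap.comp_apply, LinearMap.sub_apply,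
      LinearMap.id_apply, ← hy, this]
    rw [hy]; abel
  have hti : t ∘ₗ i = LinearMap.id := by
    ext y
    have h1 : f (i y) = 0 := (hif _).mpr ⟨y, rfl⟩
    have := LinearMap.congr_fun hr y
    simpa [ht, h1] using this
  have e1 : A = (A ∘ₗ i) ∘ₗ t + (A ∘ₗ s) ∘ₗ f := by
    conv_lhs => rw [← LinearMap.comp_id A, ← hdec]
    rw [LinearMap.comp_add]; rfl
  rw [e1, map_add, LinearMap.trace_comp_comm', LinearMap.trace_comp_comm' f, hN,
    ← LinearMap.comp_assoc, hti, LinearMap.id_comp, ← LinearMap.comp_assoc, hU,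
    LinearMap.comp_assoc, hs, LinearMap.comp_id]

/-- Frobenius: `tr (B ^ 2) = (tr B) ^ 2 = tr B` over the field with two elements. -/
theorem LinearMap.trace_pow_two_pow {V : Type*} [AddCommGroup V] [Module (ZMod 2) V]
    [FiniteDimensional (ZMod 2) V] (A : End (ZMod 2) V) (r : ℕ) :
    LinearMap.trace (ZMod 2) V (A ^ 2 ^ r) = LinearMap.trace (ZMod 2) V A := by
  have key : ∀ B : End (ZMod 2) V,
      LinearMap.trace (ZMod 2) V (B ^ 2) = LinearMap.trace (ZMod 2) V B := by
    intro B
    rw [LinearMap.trace_eq_matrix_trace _ (finBasis (ZMod 2) V),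
      LinearMap.trace_eq_matrix_trace _ (finBasis (ZMod 2) V), pow_two, LinearMap.toMatrix_mul,
      ← pow_two, ZMod.trace_pow_card, ZMod.pow_card]
  induction r with
  | zero => simp
  | succ r ih => rw [pow_succ, pow_mul, key, ih]

/-- By Cayley–Hamilton the traces satisfy the recurrence given by the characteristic polynomial. If
its degree were below `p - 1`, the recurrence would make all its coefficients zero. -/
theorem sub_one_le_finrank_of_trace_pow {V : Type*} [AddCommGroup V] [Module (ZMod 2) V]
    [FiniteDimensional (ZMod 2) V] (A : End (ZMod 2) V) (p : ℕ)
    (hA : ∀ i, LinearMap.trace (ZMod 2) V (A ^ i) = if p ∣ i then 0 else 1) :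
    p - 1 ≤ finrank (ZMod 2) V := by
  by_contra! hlt
  set q := A.charpoly
  have hdeg : q.natDegree = finrank (ZMod 2) V := LinearMap.charpoly_natDegree A
  have hrel : ∀ i, ∑ j ∈ Finset.range p, q.coeff j * (if p ∣ i + j then 0 else 1) = 0 := by
    intro i
    have h0 : A ^ i * Polynomial.aeval A q = 0 := by
      rw [LinearMap.aeval_self_charpoly, mul_zero]
    rw [Polynomial.aeval_eq_sum_range' (n := p) (by omega), Finset.mul_sum] at h0
    have h1 := congrArg (LinearMap.trace (ZMod 2) V) h0
    rw [map_sum, map_zero] at h1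
    refine (Finset.sum_congr rfl fun j _ => ?_).trans h1
    rw [mul_smul_comm, ← pow_add, map_smul, hA, smul_eq_mul]
  have hcoef : ∀ k < p, q.coeff k = ∑ j ∈ Finset.range p, q.coeff j := by
    intro k hk
    -- The shift `i = p - k` makes `j = k` the only omitted term.
    have h2 : ∀ j ∈ Finset.range p, q.coeff j * (if p ∣ (p - k) + j then 0 else 1)
        = q.coeff j - if j = k then q.coeff j else 0 := by
      intro j hj
      have hj := Finset.mem_range.mp hj
      have : p ∣ (p - k) + j ↔ j = k := by
        constructor
        · rintro ⟨c, hc⟩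
          have : c = 1 := by
            rcases c with _ | _ | c
            · omega
            · rfl
            · exfalso
              have : p * (c + 1 + 1) = p * c + p + p := by ring
              omega
          subst this
          omega
        · rintro rfl
          exact ⟨1, by omega⟩
      by_cases hjk : j = k
      · simp [hjk, show p - k + k = p by omega]
      · simp [this, hjk]
    have h3 := hrel (p - k)
    rw [Finset.sum_congr rfl h2, Finset.sum_sub_distrib, Finset.sum_ite_eq',
      if_pos (Finset.mem_range.mpr hk), sub_eq_zero] at h3
    exact h3.symm
  -- Index `p - 1` exceeds the degree, so the common value of the coefficients is zero, against
  -- monicity.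
  have hS := hcoef (p - 1) (by omega)
  rw [Polynomial.coeff_eq_zero_of_natDegree_lt (by omega)] at hS
  have := hcoef q.natDegree (by omega)
  rw [← hS, Polynomial.coeff_natDegree, (LinearMap.charpoly_monic A).leadingCoeff] at this
  exact one_ne_zero this

/-! ### The order of 2 modulo `p`. -/

theorem sOrd_eq_orderOf {p : ℕ} (hp : p.Prime) (hp_odd : Odd p) :
    sOrd p = orderOf (2 : ZMod p) := by
  have : Fact p.Prime := ⟨hp⟩
  have h2 : (2 : ZMod p) ≠ 0 := by
    intro h
    have : p ∣ 2 := (ZMod.natCast_eq_zero_iff 2 p).mp (by exact_mod_cast h)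
    rw [(Nat.prime_dvd_prime_iff_eq hp Nat.prime_two).mp this] at hp_odd
    exact absurd hp_odd (by decide)
  have hiff : ∀ s, p ∣ 2 ^ s - 1 ↔ (2 : ZMod p) ^ s = 1 := by
    intro s
    rw [← ZMod.natCast_eq_zero_iff, Nat.cast_sub Nat.one_le_two_pow, sub_eq_zero]
    push_cast
    rfl
  have hpos : 0 < orderOf (2 : ZMod p) :=
    Nat.pos_of_dvd_of_pos (ZMod.orderOf_dvd_card_sub_one h2) (by have := hp.two_le; omega)
  refine le_antisymm (Nat.sInf_le ⟨hpos, (hiff _).mpr (pow_orderOf_eq_one _)⟩) ?_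
  refine le_csInf ⟨_, hpos, (hiff _).mpr (pow_orderOf_eq_one _)⟩ ?_
  rintro s ⟨hs, hs'⟩
  exact orderOf_le_of_pow_eq_one hs ((hiff s).mp hs')

theorem sOrd_mul_nuOf {p : ℕ} (hp : p.Prime) (hp_odd : Odd p) : sOrd p * nuOf p = p - 1 := by
  have : Fact p.Prime := ⟨hp⟩
  have h2 : (2 : ZMod p) ≠ 0 := by
    intro h
    have : p ∣ 2 := (ZMod.natCast_eq_zero_iff 2 p).mp (by exact_mod_cast h)
    rw [(Nat.prime_dvd_prime_iff_eq hp Nat.prime_two).mp this] at hp_odd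
    exact absurd hp_odd (by decide)
  unfold nuOf
  rw [sOrd_eq_orderOf hp hp_odd]
  exact Nat.mul_div_cancel' (ZMod.orderOf_dvd_card_sub_one h2)

/-- With `r = s(p)/2`, the residue `2 ^ r` is a square root of 1 other than 1, hence -1. -/
theorem exists_dvd_two_pow_add_one {p : ℕ} (hp : p.Prime) (hp_odd : Odd p)
    (hs : Even (sOrd p)) : ∃ r, p ∣ 2 ^ r + 1 := by
  have : Fact p.Prime := ⟨hp⟩
  obtain ⟨r, hr⟩ := hs
  have hmul := sOrd_mul_nuOf hp hp_odd
  rw [sOrd_eq_orderOf hp hp_odd] at hr hmul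
  have hr0 : 0 < r := by
    rcases Nat.eq_zero_or_pos r with h | h
    · have := hp.two_le
      rw [hr, h] at hmul
      omega
    · exact h
  have hsq : ((2 : ZMod p) ^ r) * (2 : ZMod p) ^ r = 1 := by
    rw [← pow_add, ← hr, pow_orderOf_eq_one]
  refine ⟨r, (ZMod.natCast_eq_zero_iff _ p).mp ?_⟩
  rcases mul_self_eq_one_iff.mp hsq with h | h
  · have := orderOf_le_of_pow_eq_one hr0 h
    omega
  · push_cast
    rw [h]; ring

/-! ### Self-orthogonal codes invariant under a permutation. -/

theorem LinearMap.trace_funLeft_perm {m : ℕ} (σ : Equiv.Perm (Fin m)) :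
    LinearMap.trace K (Fin m → K) (LinearMap.funLeft K K σ)
      = ((Function.fixedPoints σ).ncard : K) := by
  rw [← Matrix.trace_permutation σ, ← Matrix.trace_toLin'_eq]
  congr 1
  ext v i
  rw [LinearMap.comp_apply, LinearMap.comp_apply, Matrix.toLin'_apply, Matrix.permMatrix_mulVec]
  rfl

theorem mem_dualCode {m : ℕ} {D : Submodule K (Fin m → K)} {v : Fin m → K} :
    v ∈ dualCode D ↔ ∀ c ∈ D, ∑ i, v i * c i = 0 := Iff.rfl

/-- The standard inner product as a map from words to functionals on a code. -/
def codePairing {m : ℕ} (D : Submodule K (Fin m → K)) : (Fin m → K) →ₗ[K] Dual K D :=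
  D.subtype.dualMap ∘ₗ (dotProductEquiv K (Fin m)).toLinearMap

theorem codePairing_apply {m : ℕ} (D : Submodule K (Fin m → K)) (v : Fin m → K) (c : D) :
    codePairing D v c = ∑ i, v i * (c : Fin m → K) i := rfl

theorem codePairing_surjective {m : ℕ} (D : Submodule K (Fin m → K)) :
    Function.Surjective (codePairing D) :=
  (LinearMap.dualMap_surjective_of_injective D.injective_subtype).comp
    (dotProductEquiv K (Fin m)).surjective

theorem codePairing_eq_zero {m : ℕ} (D : Submodule K (Fin m → K)) (v : Fin m → K) :
    codePairing D v = 0 ↔ v ∈ dualCode D := by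
  refine ⟨fun h c hc => ?_, fun h => ?_⟩
  · exact LinearMap.congr_fun h ⟨c, hc⟩
  · ext c
    exact h c c.2

theorem finrank_add_finrank_dualCode {m : ℕ} (D : Submodule K (Fin m → K)) :
    finrank K D + finrank K (dualCode D) = m := by
  have hk : LinearMap.ker (codePairing D) = dualCode D := by
    ext v
    exact codePairing_eq_zero D v
  have h := LinearMap.finrank_range_add_finrank_ker (codePairing D)
  rwa [LinearMap.range_eq_top.mpr (codePairing_surjective D), finrank_top,
    Subspace.dual_finrank_eq, hk, finrank_fin_fun] at h

/-- The filtration `D ⊆ D^⊥ ⊆ K^m` splits the trace into three, and the outer two agree. The induced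
maps are arbitrary so that powers of fixed ones can be inserted. -/
theorem trace_eq_trace_dualCode_quotient {m r : ℕ} {D : Submodule K (Fin m → K)}
    (hD : D ≤ dualCode D) {A : End K (Fin m → K)}
    (hA : ∀ v w, ∑ i, A v i * A w i = ∑ i, v i * w i) (hr : A ^ (2 ^ r + 1) = 1)
    (AD : End K D) (AE : End K (dualCode D)) (AQ : End K (dualCode D ⧸ D.submoduleOf (dualCode D)))
    (hAD : A ∘ₗ D.subtype = D.subtype ∘ₗ AD)
    (hAE : A ∘ₗ (dualCode D).subtype = (dualCode D).subtype ∘ₗ AE)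
    (hAQ : (D.submoduleOf (dualCode D)).mkQ ∘ₗ AE = AQ ∘ₗ (D.submoduleOf (dualCode D)).mkQ) :
    LinearMap.trace K (Fin m → K) A
      = LinearMap.trace K (dualCode D ⧸ D.submoduleOf (dualCode D)) AQ := by
  have h1 : LinearMap.trace K _ A = LinearMap.trace K _ AE +
      LinearMap.trace K _ (AD ^ 2 ^ r).dualMap := by
    refine LinearMap.trace_eq_add_of_exact (dualCode D).subtype (codePairing D)
      (dualCode D).injective_subtype (codePairing_surjective D) ?_ A AE _ hAE ?_
    · intro v
      rw [codePairing_eq_zero]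
      simp
    · refine LinearMap.ext fun v => LinearMap.ext fun c => ?_
      have hpow := LinearMap.congr_fun
        (Module.End.commute_pow_left_of_commute (g := AD) (f := D.subtype) (g₂ := A) hAD (2 ^ r)) c
      rw [LinearMap.comp_apply, LinearMap.comp_apply, LinearMap.dualMap_apply, codePairing_apply,
        codePairing_apply]
      -- The adjoint of the isometry `A` is its inverse `A ^ 2 ^ r`.
      have hc : (c : Fin m → K) = A ((A ^ 2 ^ r) c) := by
        rw [← Module.End.mul_apply, ← pow_succ', hr]
        rfl
      rw [hc, hA]
      simp only [LinearMap.comp_apply, Submodule.subtype_apply] at hpow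
      rw [hpow]
  have h2 : LinearMap.trace K _ AE = LinearMap.trace K _ AD + LinearMap.trace K _ AQ := by
    refine LinearMap.trace_eq_add_of_exact (Submodule.inclusion hD)
      (D.submoduleOf (dualCode D)).mkQ (Submodule.inclusion_injective hD)
      (Submodule.mkQ_surjective _) ?_ AE AD AQ ?_ hAQ
    · intro v
      rw [Submodule.mkQ_apply, Submodule.Quotient.mk_eq_zero]
      exact ⟨fun h => ⟨⟨v, h⟩, rfl⟩, by rintro ⟨c, rfl⟩; exact c.2⟩
    · ext c : 2
      exact (LinearMap.congr_fun hAE (Submodule.inclusion hD c)).symm.trans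
        (LinearMap.congr_fun hAD c)
  have h3 : LinearMap.trace K _ (AD ^ 2 ^ r).dualMap = LinearMap.trace K _ AD := by
    rw [← LinearMap.trace_pow_two_pow AD r]
    exact LinearMap.trace_transpose' _
  rw [h1, h2, h3, add_right_comm, CharTwo.add_self_eq_zero, zero_add]

theorem two_mul_finrank_add_le_of_self_orthogonal {m p r : ℕ} (hp : p.Prime)
    (hr : p ∣ 2 ^ r + 1) (hm : Even m) (σ : Equiv.Perm (Fin m)) (hσ : σ ^ p = 1)
    (hfix : Odd (Function.fixedPoints σ).ncard) (D : Submodule K (Fin m → K))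
    (hD : D ≤ dualCode D) (hσD : ∀ v ∈ D, v ∘ σ ∈ D) :
    2 * finrank K D + (p - 1) ≤ m := by
  set A : End K (Fin m → K) := LinearMap.funLeft K K σ with hAdef
  have hApow : ∀ k, A ^ k = LinearMap.funLeft K K (σ ^ k : Equiv.Perm (Fin m)) := by
    intro k
    induction k with
    | zero => rfl
    | succ k ih => rw [pow_succ', ih]; rfl
  have hAiso : ∀ k, ∀ v w, ∑ i, (A ^ k) v i * (A ^ k) w i = ∑ i, v i * w i := by
    intro k v w
    rw [hApow]
    exact Equiv.sum_comp (σ ^ k : Equiv.Perm (Fin m)) fun i => v i * w i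
  have hAone : ∀ k, (A ^ k) ^ (2 ^ r + 1) = 1 := by
    intro k
    obtain ⟨c, hc⟩ := hr
    have : σ ^ (k * (2 ^ r + 1)) = 1 := by
      rw [hc, mul_left_comm, pow_mul, hσ, one_pow]
    rw [← pow_mul, hApow, this]
    rfl
  have hAD : ∀ v ∈ D, A v ∈ D := hσD
  have hADk : ∀ k, ∀ v ∈ D, (A ^ k) v ∈ D := by
    intro k
    induction k with
    | zero => exact fun v hv => hv
    | succ k ih => exact fun v hv => by rw [pow_succ']; exact hAD _ (ih v hv)
  have hAE : ∀ v ∈ dualCode D, A v ∈ dualCode D := by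
    intro v hv c hc
    have : c = A ((A ^ 2 ^ r) c) := by
      have h := LinearMap.congr_fun (hAone 1) c
      rw [pow_one, pow_succ'] at h
      exact h.symm
    rw [this]
    have h := hAiso 1 v ((A ^ 2 ^ r) c)
    rw [pow_one] at h
    rw [h]
    exact hv _ (hADk _ c hc)
  set N := D.submoduleOf (dualCode D)
  set AD : End K D := A.restrict hAD
  set AE : End K (dualCode D) := A.restrict hAE
  have hAN : N ≤ N.comap AE := fun v hv => hAD _ hv
  set AQ : End K (dualCode D ⧸ N) := N.mapQ N AE hAN
  have htr : ∀ i, LinearMap.trace K _ (AQ ^ i) = if p ∣ i then 0 else 1 := by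
    intro i
    rw [← trace_eq_trace_dualCode_quotient hD (hAiso i) (hAone i) (AD ^ i) (AE ^ i) (AQ ^ i)
      (Module.End.commute_pow_left_of_commute (g := AD) (f := D.subtype) (g₂ := A) rfl i)
      (Module.End.commute_pow_left_of_commute (g := AE) (f := (dualCode D).subtype) (g₂ := A) rfl i)
      (Module.End.commute_pow_left_of_commute (g := AE) (f := N.mkQ) (g₂ := AQ) rfl i).symm,
      hApow, LinearMap.trace_funLeft_perm]
    split_ifs with hi
    · obtain ⟨c, rfl⟩ := hi
      have : Function.fixedPoints (σ ^ (p * c) : Equiv.Perm (Fin m)) = Set.univ := by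
        rw [pow_mul, hσ, one_pow]
        exact Set.eq_univ_of_forall fun x => rfl
      rw [this, Set.ncard_univ, Nat.card_eq_fintype_card, Fintype.card_fin]
      exact (ZMod.natCast_eq_zero_iff_even).mpr hm
    · have : Function.fixedPoints (σ ^ i : Equiv.Perm (Fin m)) = Function.fixedPoints σ := by
        -- For `p ∤ i`, `σ` is itself a power of `σ ^ i`, so both have the same fixed points.
        have hcop : Nat.Coprime (orderOf σ) i := by
          exact Nat.Coprime.coprime_dvd_left (orderOf_dvd_of_pow_eq_one hσ)
            ((Nat.Prime.coprime_iff_not_dvd hp).mpr hi)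
        obtain ⟨k, hk⟩ := exists_pow_eq_self_of_coprime hcop.symm
        ext x
        refine ⟨fun h => ?_, fun h => ?_⟩
        · have h' := Equiv.Perm.pow_apply_eq_self_of_apply_eq_self (f := σ ^ i) h k
          rw [hk] at h'
          exact h'
        · exact Equiv.Perm.pow_apply_eq_self_of_apply_eq_self h i
      rw [this]
      exact (ZMod.natCast_eq_one_iff_odd).mpr hfix
  have hle : p - 1 ≤ finrank K (dualCode D ⧸ N) := sub_one_le_finrank_of_trace_pow AQ p htr
  have h1 : finrank K (dualCode D ⧸ N) + finrank K N = finrank K (dualCode D) :=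
    N.finrank_quotient_add_finrank
  have h2 : finrank K N = finrank K D := (Submodule.submoduleOfEquivOfLe hD).finrank_eq
  have h3 := finrank_add_finrank_dualCode D
  omega

/-! ### 2-cycles, pairs and the induced permutation. -/

theorem Equiv.Perm.card_filter_apply_apply_eq {α : Type*} [Fintype α] [DecidableEq α]
    (g : Equiv.Perm α) (hg : ∀ x, g x ≠ x) :
    (Finset.univ.filter fun x => g (g x) = x).card = 2 * g.cycleType.count 2 := by
  have hset : (Finset.univ.filter fun x => g (g x) = x) =
      (g.cycleFactorsFinset.filter fun c => c.support.card = 2).biUnion fun c => c.support := by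
    ext x
    simp only [Finset.mem_filter, Finset.mem_univ, true_and, Finset.mem_biUnion]
    have hcyc := Equiv.Perm.isCycle_cycleOf g (hg x)
    have hx : g.cycleOf x x ≠ x := by rw [Equiv.Perm.cycleOf_apply_self]; exact hg x
    have hsq : (g.cycleOf x ^ 2) x = g (g x) := Equiv.Perm.cycleOf_pow_apply_self g x 2
    constructor
    · intro h
      refine ⟨g.cycleOf x, ⟨?_, ?_⟩, Equiv.Perm.mem_support.mpr hx⟩
      · rw [Equiv.Perm.cycleOf_mem_cycleFactorsFinset_iff]
        exact Equiv.Perm.mem_support.mpr (hg x)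
      · rw [← hcyc.orderOf]
        exact orderOf_eq_prime (hcyc.pow_eq_one_iff.mpr ⟨x, hx, hsq.trans h⟩) hcyc.ne_one
    · rintro ⟨c, ⟨hc, hcard⟩, hxc⟩
      rw [Equiv.Perm.cycle_is_cycleOf hxc hc, ← hcyc.orderOf] at hcard
      rw [← hsq, ← hcard, pow_orderOf_eq_one]
      rfl
  rw [hset, Finset.card_biUnion, Finset.sum_const_nat (m := 2), mul_comm,
    Equiv.Perm.cycleType_def, Multiset.count_map]
  · congr 1
    rw [Finset.card_def, Finset.filter_val]
    congr 1
    exact Multiset.filter_congr fun c _ => eq_comm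
  · intro c hc
    exact (Finset.mem_filter.mp hc).2
  · intro c hc d hd hcd
    exact Equiv.Perm.Disjoint.disjoint_support (g.cycleFactorsFinset_pairwise_disjoint
      (Finset.mem_filter.mp hc).1 (Finset.mem_filter.mp hd).1 hcd)

theorem exists_isPairing {n : ℕ} (h : Equiv.Perm (Fin n)) (hh : ∀ i, h (h i) = i)
    (h_free : ∀ i, h i ≠ i) : ∃ e : Fin (n / 2) × Fin 2 ≃ Fin n, IsPairing h e := by
  let f : {i : Fin n // i < h i} × Fin 2 → Fin n := fun q => if q.2 = 0 then q.1 else h q.1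
  have hf : Function.Bijective f := by
    constructor
    · rintro ⟨⟨x, hx⟩, a⟩ ⟨⟨y, hy⟩, b⟩ hxy
      fin_cases a <;> fin_cases b <;> simp [f] at hxy ⊢
      · exact hxy
      · subst hxy
        rw [hh] at hx
        exact lt_asymm hx hy
      · subst hxy
        rw [hh] at hy
        exact lt_asymm hx hy
      · exact hxy
    · intro x
      rcases lt_or_gt_of_ne (h_free x) with hx | hx
      · exact ⟨(⟨h x, by rwa [hh]⟩, 1), by simp [f, hh]⟩
      · exact ⟨(⟨x, hx⟩, 0), by simp [f]⟩
  have hcard : Fintype.card {i : Fin n // i < h i} = n / 2 := by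
    have := Fintype.card_of_bijective hf
    rw [Fintype.card_prod, Fintype.card_fin, Fintype.card_fin] at this
    omega
  let t := (Fintype.equivFinOfCardEq hcard).symm
  refine ⟨(t.prodCongr (Equiv.refl _)).trans (Equiv.ofBijective f hf), fun j => ?_⟩
  simp [f, hh]

namespace IsPairing

variable {n : ℕ} {h : Equiv.Perm (Fin n)} {e : Fin (n / 2) × Fin 2 ≃ Fin n}

theorem apply_apply (he : IsPairing h e) (x : Fin n) : h (h x) = x := by
  obtain ⟨⟨j, a⟩, rfl⟩ := e.surjective x
  fin_cases a
  · exact (congrArg h (he j).1).trans (he j).2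
  · exact (congrArg h (he j).2).trans (he j).1

theorem index_apply (he : IsPairing h e) (x : Fin n) : (e.symm (h x)).1 = (e.symm x).1 := by
  obtain ⟨⟨j, a⟩, rfl⟩ := e.surjective x
  fin_cases a
  · exact (congrArg (fun y => (e.symm y).1) (he j).1).trans (by simp)
  · exact (congrArg (fun y => (e.symm y).1) (he j).2).trans (by simp)

theorem eq_or_eq_of_index_eq (he : IsPairing h e) {x y : Fin n}
    (hxy : (e.symm x).1 = (e.symm y).1) : x = y ∨ x = h y := by
  obtain ⟨⟨i, a⟩, rfl⟩ := e.surjective x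
  obtain ⟨⟨j, b⟩, rfl⟩ := e.surjective y
  simp only [Equiv.symm_apply_apply] at hxy
  subst hxy
  fin_cases a <;> fin_cases b
  · exact Or.inl rfl
  · exact Or.inr (he i).2.symm
  · exact Or.inr (he i).1.symm
  · exact Or.inl rfl

theorem index_commute_apply (he : IsPairing h e) {σ : Equiv.Perm (Fin n)} (hσ : Commute σ h)
    (x : Fin n) : (e.symm (σ x)).1 = (e.symm (σ (e ((e.symm x).1, 0)))).1 := by
  have : (e.symm (e ((e.symm x).1, 0))).1 = (e.symm x).1 := by simp
  rcases he.eq_or_eq_of_index_eq this with h1 | h1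
  · rw [h1]
  · rw [h1, show σ (h x) = h (σ x) from congrArg (fun τ : Equiv.Perm (Fin n) => τ x) hσ,
      he.index_apply]

/-- The permutation of the pairs induced by a permutation commuting with the involution. -/
def pairPerm (he : IsPairing h e) {σ : Equiv.Perm (Fin n)} (hσ : Commute σ h) :
    Equiv.Perm (Fin (n / 2)) where
  toFun j := (e.symm (σ (e (j, 0)))).1
  invFun j := (e.symm (σ⁻¹ (e (j, 0)))).1
  left_inv j := (he.index_commute_apply hσ.inv_left _).symm.trans (by simp)
  right_inv j := (he.index_commute_apply hσ _).symm.trans (by simp)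

theorem pairPerm_index (he : IsPairing h e) {σ : Equiv.Perm (Fin n)} (hσ : Commute σ h)
    (x : Fin n) : he.pairPerm hσ (e.symm x).1 = (e.symm (σ x)).1 :=
  (he.index_commute_apply hσ x).symm

theorem pairPerm_pow_index (he : IsPairing h e) {σ : Equiv.Perm (Fin n)} (hσ : Commute σ h)
    (k : ℕ) (x : Fin n) : (he.pairPerm hσ ^ k) (e.symm x).1 = (e.symm ((σ ^ k) x)).1 := by
  induction k with
  | zero => rfl
  | succ k ih =>
    rw [pow_succ', Equiv.Perm.mul_apply, ih, pairPerm_index, pow_succ', Equiv.Perm.mul_apply]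

theorem pairPerm_pow_eq_one {g : Equiv.Perm (Fin n)} {p : ℕ} (he : IsPairing (g ^ p) e) :
    he.pairPerm (Commute.self_pow g p) ^ p = 1 := by
  ext1 j
  obtain ⟨x, rfl⟩ : ∃ x, (e.symm x).1 = j := ⟨e (j, 0), by simp⟩
  rw [pairPerm_pow_index, he.index_apply]
  rfl

/-- On a 2-cycle of `g`, `g ^ p = g` as `p` is odd, so the 2-cycle is a fixed pair. Conversely, on a
fixed pair `g`, having no fixed points, must act as the swap `g ^ p`. -/
theorem ncard_fixedPoints_pairPerm {g : Equiv.Perm (Fin n)} {p : ℕ} (hp : Odd p)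
    (he : IsPairing (g ^ p) e) (h_free : ∀ i, (g ^ p) i ≠ i) :
    (Function.fixedPoints (he.pairPerm (Commute.self_pow g p))).ncard = g.cycleType.count 2 := by
  classical
  set τ := he.pairPerm (Commute.self_pow g p) with hτ
  have hg : ∀ x, g x ≠ x := fun x hx =>
    h_free x (Equiv.Perm.pow_apply_eq_self_of_apply_eq_self hx p)
  have hiff : ∀ x, g (g x) = x ↔ τ (e.symm x).1 = (e.symm x).1 := by
    intro x
    rw [hτ, pairPerm_index]
    constructor
    · intro hx
      obtain ⟨k, rfl⟩ := hp
      have h1 : (g ^ (2 * k + 1)) x = g x := by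
        rw [pow_succ', Equiv.Perm.mul_apply, pow_mul]
        exact congrArg g (Equiv.Perm.pow_apply_eq_self_of_apply_eq_self (f := g ^ 2) hx k)
      rw [← h1, he.index_apply]
    · intro hx
      rcases he.eq_or_eq_of_index_eq hx with h1 | h1
      · exact absurd h1 (hg x)
      · have h2 : g ((g ^ p) x) = (g ^ p) (g x) :=
          congrArg (fun ρ : Equiv.Perm (Fin n) => ρ x) (Commute.self_pow g p)
        rw [h1, h2, h1, he.apply_apply]
  have hcard : (Finset.univ.filter fun x => g (g x) = x).card =
      ((Finset.univ.filter fun j => τ j = j) ×ˢ (Finset.univ : Finset (Fin 2))).card := by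
    refine Finset.card_equiv e.symm fun x => ?_
    simp [hiff]
  rw [g.card_filter_apply_apply_eq hg, Finset.card_product, Finset.card_univ, Fintype.card_fin]
    at hcard
  have hset : Function.fixedPoints τ =
      ((Finset.univ.filter fun j => τ j = j : Finset _) : Set _) := by
    ext j
    simp [Function.mem_fixedPoints, Function.IsFixedPt]
  rw [hset, Set.ncard_coe_finset]
  omega

/-! ### Duality between `φ(C)` and `π(C(h))`. -/

theorem sum_eq (e : Fin (n / 2) × Fin 2 ≃ Fin n) (f : Fin n → K) :
    ∑ i, f i = ∑ j, (f (e (j, 0)) + f (e (j, 1))) := by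
  rw [← e.sum_comp, Fintype.sum_prod_type]
  simp

theorem phiMap_index (he : IsPairing h e) (c : Fin n → K) (x : Fin n) :
    phiMap e c (e.symm x).1 = c x + c (h x) := by
  obtain ⟨⟨j, a⟩, rfl⟩ := e.surjective x
  rw [Equiv.symm_apply_apply]
  change c (e (j, 0)) + c (e (j, 1)) = _
  fin_cases a
  · exact congrArg (fun y => c (e (j, 0)) + c y) (he j).1.symm
  · rw [add_comm]
    exact congrArg (fun y => c (e (j, 1)) + c y) (he j).2.symm

theorem permWord_eq_iff (he : IsPairing h e) (c : Fin n → K) :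
    permWord h c = c ↔ ∀ x, c (h x) = c x := by
  have hsymm : ∀ x, h.symm x = h x := fun x => by
    rw [Equiv.symm_apply_eq, he.apply_apply]
  rw [funext_iff]
  simp only [permWord, hsymm]

/-- If `u` repeats `v` on each pair, then `⟨u, c⟩ = ⟨v, φ(c)⟩`; self-duality turns orthogonality to
`C` into membership. -/
theorem dualCode_map_phiMap (he : IsPairing h e) {C : Submodule K (Fin n → K)}
    (hC : IsSelfDualCode C) :
    dualCode (C.map (phiMap e)) = (fixedSubcode C h).map (piMap e) := by
  ext v
  constructor
  · intro hv
    refine ⟨fun i => v (e.symm i).1, ⟨?_, ?_⟩, ?_⟩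
    · rw [← hC]
      intro c hc
      rw [sum_eq e, ← hv (phiMap e c) ⟨c, hc, rfl⟩]
      refine Finset.sum_congr rfl fun j _ => ?_
      simp only [Equiv.symm_apply_apply]
      exact (mul_add _ _ _).symm
    · rw [he.permWord_eq_iff]
      intro x
      rw [he.index_apply]
    · funext j
      exact congrArg (fun q : Fin (n / 2) × Fin 2 => v q.1) (e.symm_apply_apply (j, 0))
  · rintro ⟨c, ⟨hc, hfix⟩, rfl⟩ _ ⟨d, hd, rfl⟩
    rw [he.permWord_eq_iff] at hfix
    have hcd : ∑ i, c i * d i = 0 := by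
      rw [← hC] at hc
      exact hc d hd
    rw [← hcd, sum_eq e]
    refine Finset.sum_congr rfl fun j _ => ?_
    rw [← (he j).1, hfix, (he j).1]
    exact mul_add _ _ _

/-- `φ(c) = π(c + c^h)`, and `c + c^h` is fixed by `h`. -/
theorem map_phiMap_le_dualCode (he : IsPairing h e) {C : Submodule K (Fin n → K)}
    (hC : IsSelfDualCode C) (hh : h ∈ codeAut C) :
    C.map (phiMap e) ≤ dualCode (C.map (phiMap e)) := by
  rw [he.dualCode_map_phiMap hC]
  rintro _ ⟨c, hc, rfl⟩
  refine ⟨c + permWord h⁻¹ c, ⟨C.add_mem hc ((inv_mem hh c).mpr hc), ?_⟩, ?_⟩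
  · rw [he.permWord_eq_iff]
    intro x
    change c (h x) + c (h (h x)) = c x + c (h x)
    rw [he.apply_apply, add_comm]
  · funext j
    exact congrArg (fun y => c (e (j, 0)) + c y) (he j).1

theorem comp_pairPerm_mem (he : IsPairing h e) {σ : Equiv.Perm (Fin n)} (hσ : Commute σ h)
    {C : Submodule K (Fin n → K)} (hσC : σ ∈ codeAut C) {v : Fin (n / 2) → K}
    (hv : v ∈ C.map (phiMap e)) : v ∘ he.pairPerm hσ ∈ C.map (phiMap e) := by
  obtain ⟨c, hc, rfl⟩ := hv
  refine ⟨permWord σ⁻¹ c, (inv_mem hσC c).mpr hc, ?_⟩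
  funext j
  obtain ⟨x, rfl⟩ : ∃ x, (e.symm x).1 = j := ⟨e (j, 0), by simp⟩
  rw [he.phiMap_index, Function.comp_apply, he.pairPerm_index, he.phiMap_index]
  exact congrArg (fun y => c (σ x) + c y) (congrArg (fun ρ : Equiv.Perm (Fin n) => ρ x) hσ)

theorem finrank_map_piMap (he : IsPairing h e) (C : Submodule K (Fin n → K)) :
    finrank K (fixedSubcode C h) = finrank K ((fixedSubcode C h).map (piMap e)) := by
  have hinj : Function.Injective ((piMap e).domRestrict (fixedSubcode C h)) := by
    rw [← LinearMap.ker_eq_bot, LinearMap.ker_eq_bot']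
    rintro ⟨c, hc, hfix⟩ h0
    rw [he.permWord_eq_iff] at hfix
    have hz : ∀ j, c (e (j, 0)) = 0 := fun j => congrFun h0 j
    ext x
    obtain ⟨⟨j, a⟩, rfl⟩ := e.surjective x
    fin_cases a
    · exact hz j
    · exact (congrArg c (he j).1.symm).trans ((hfix _).trans (hz j))
  rw [← LinearMap.range_domRestrict, LinearMap.finrank_range_of_inj hinj]

theorem two_mul_finrank_map_phiMap_add_le {g : Equiv.Perm (Fin n)} {p : ℕ} (hp : p.Prime)
    (hp_odd : Odd p) (he : IsPairing (g ^ p) e) {C : Submodule K (Fin n → K)}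
    (hC : IsSelfDualCode C) (hg : g ∈ codeAut C) (h_free : ∀ i, (g ^ p) i ≠ i) (hn : 4 ∣ n)
    (hs : Even (sOrd p)) (hw : Odd (g.cycleType.count 2)) :
    2 * finrank K (C.map (phiMap e)) + (p - 1) ≤ n / 2 := by
  obtain ⟨r, hr⟩ := exists_dvd_two_pow_add_one hp hp_odd hs
  refine two_mul_finrank_add_le_of_self_orthogonal hp hr ?_
    (he.pairPerm (Commute.self_pow g p)) he.pairPerm_pow_eq_one ?_ _
    (he.map_phiMap_le_dualCode hC (pow_mem hg p))
    fun v hv => he.comp_pairPerm_mem (Commute.self_pow g p) hg hv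
  · obtain ⟨k, rfl⟩ := hn
    exact ⟨k, by omega⟩
  · rwa [he.ncard_fixedPoints_pairPerm hp_odd h_free]

end IsPairing

/-! ### The dimension bound and strictness. -/

theorem mainTheorem6 (n p : ℕ) (hp : p.Prime) (hp_odd : Odd p)
    (C : Submodule K (Fin n → K)) (hC : IsSelfDualCode C)
    (g : Equiv.Perm (Fin n)) (hg : g ∈ codeAut C) (hg_order : orderOf g = 2 * p)
    (h_free : ∀ i, (g ^ p) i ≠ i)
    (hn : 4 ∣ n) (hs : Even (sOrd p)) (hw : Odd (g.cycleType.count 2)) :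
    (n : ℚ) / 4 + ((sOrd p : ℚ) * nuOf p) / 2 ≤ Module.finrank K (fixedSubcode C (g ^ p)) ∧
    (n : ℚ) / 4 + ((sOrd p : ℚ) * nuOf p) / 2 = (n : ℚ) / 4 + ((p : ℚ) - 1) / 2 ∧
    ∀ e : Fin (n / 2) × Fin 2 ≃ Fin n, IsPairing (g ^ p) e →
      Module.finrank K (fixedSubcode C (g ^ p)) =
        Module.finrank K ((fixedSubcode C (g ^ p)).map (piMap e)) ∧
      C.map (phiMap e) < dualCode (C.map (phiMap e)) := by
  have hsν : (sOrd p : ℚ) * nuOf p = (p : ℚ) - 1 := by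
    rw [← Nat.cast_mul, sOrd_mul_nuOf hp hp_odd, Nat.cast_sub hp.one_le, Nat.cast_one]
  have hp2 := hp.two_le
  refine ⟨?_, by rw [hsν], fun e he => ⟨he.finrank_map_piMap C, ?_⟩⟩
  · have hinv : ∀ i, (g ^ p) ((g ^ p) i) = i := fun i => by
      rw [← Equiv.Perm.mul_apply, ← pow_add, ← two_mul, ← hg_order, pow_orderOf_eq_one]
      rfl
    obtain ⟨e, he⟩ := exists_isPairing (g ^ p) hinv h_free
    have h1 := he.two_mul_finrank_map_phiMap_add_le hp hp_odd hC hg h_free hn hs hw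
    have h2 := finrank_add_finrank_dualCode (C.map (phiMap e))
    rw [he.dualCode_map_phiMap hC, ← he.finrank_map_piMap C] at h2
    obtain ⟨k, rfl⟩ := hn
    have h3 : 2 * k + p ≤ 2 * finrank K (fixedSubcode C (g ^ p)) + 1 := by omega
    have h4 : (2 * k + p : ℚ) ≤ 2 * finrank K (fixedSubcode C (g ^ p)) + 1 := by exact_mod_cast h3
    rw [hsν]
    push_cast
    linarith
  · refine lt_of_le_of_ne (he.map_phiMap_le_dualCode hC (pow_mem hg p)) fun heq => ?_
    -- Equality would give `2 dim φ(C) = n/2`, leaving no room for `p - 1 > 0`.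
    have h1 := he.two_mul_finrank_map_phiMap_add_le hp hp_odd hC hg h_free hn hs hw
    have h2 := finrank_add_finrank_dualCode (C.map (phiMap e))
    rw [← heq] at h2
    omega
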